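/- Let $n\ge 0$. The number $f_n$ of forests of unrooted trees on the vertex set $[n]=\{1,\dots,n\}$ (that is, of acyclic simple graphs on $[n]$) is $$f_n=\frac{n!}{n+1}\sum_{j=0}^{\lfloor n/2\rfloor}(-1)^j\frac{(2j+1)(n+1)^{n-2j}}{2^j\,j!\,(n-2j)!} =\sum_{0\le j\le n/2}(-1)^j\binom{n}{2j}(2j-1)!!\,(2j+1)(n+1)^{n-2j-1},$$ where $(2j-1)!!=1\cdot3\cdots(2j-1)$, with value $1$ for $j=0$. Moreover, call *PPR forest* (partially-paired rooted $n$-forest) a configuration consisting of a tree rooted at $0$ and zero or more unordered pairs of rooted trees, where the vertex sets of all the trees form a partition of $\{0,1,\dots,n\}$. Its *pair-count* $j$ is the number of pairs, and its *weight* is $(-1)^j$. Descendants are always proper. A vertex is *inversion-initiating* if some descendant of it is smaller than it, and *regular* otherwise. A PPR forest is *special* if its pair-count is $0$ and all children of $0$ are regular. Then: 1. For every $j\ge 0$, the number of PPR forests with pair-count $j$ is $\binom{n}{2j}(2j-1)!!\,(2j+1)(n+1)^{n-2j-1}$. The total weight of all PPR forests is the second sum above. 2. Special PPR forests have weight $1$,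 and deleting the vertex $0$ and forgetting the roots is a bijection from the special PPR forests onto the forests of unrooted trees on $[n]$. 3. There is a weight-reversing involution $\varphi$ on the set of non-special PPR forests. It acts as follows. Let $a$ be the smallest vertex, if any, that is not in the tree rooted at $0$, and let $a'$ be the smallest, if any, among all descendants of inversion-initiating children of $0$ (at least one of $a,a'$ exists). If $a$ exists and $a'$ does not, or $a<a'$: let $u$ be the root of the tree of $a$ and $v$ the root of the other tree of its pair; $\varphi$ removes this pair and adds the edges $0v$ and $vu$, making $v$ a child of $0$ and $u$ a child of $v$. Otherwise: let $v'$ be the child of $0$ of which $a'$ is a descendant and $u'$ the child of $v'$ on the path from $v'$ to $a'$ (possibly $u'=a'$); $\varphi$ deletes the edges $0v'$ and $v'u'$ and makes the trees then rooted at $u'$ and $v'$ a new pair. -/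

import Mathlib

/-- A partially-paired rooted `n`-forest, on the vertex set `{0, …, n}`: a rooted forest in which
`0` is one of the roots, together with a division of the other roots (hence of the other trees)
into unordered pairs.

The rooted forest is given by its parent map, which fixes exactly the roots and under whose
iteration every vertex reaches a root.  The pairing is given by the involution `mate`, which
exchanges the two roots of each pair and fixes every other vertex. -/
@[ext]
structure PPRForest (n : ℕ) where
  parent : Fin (n + 1) → Fin (n + 1)
  parent_zero : parent 0 = 0
  exists_root : ∀ v, ∃ k : ℕ, parent (parent^[k] v) = parent^[k] v
  mate : Fin (n + 1) → Fin (n + 1)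
  mate_mate : ∀ v, mate (mate v) = v
  mate_ne_iff : ∀ v, mate v ≠ v ↔ v ≠ 0 ∧ parent v = v

namespace PPRForest

theorem injective_parent_mate (n : ℕ) :
    Function.Injective (fun F : PPRForest n => (F.parent, F.mate)) := by
  intro F G h
  exact PPRForest.ext (congrArg Prod.fst h) (congrArg Prod.snd h)

noncomputable instance (n : ℕ) : Fintype (PPRForest n) :=
  Fintype.ofInjective _ (injective_parent_mate n)

variable {n : ℕ} (F : PPRForest n)

/-- The number of pairs of trees; each pair is counted at the smaller of its two roots. -/
def pairCount : ℕ := (Finset.univ.filter fun v => v < F.mate v).card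

/-- The weight of a partially-paired rooted forest. -/
def weight : ℤ := (-1) ^ F.pairCount

/-- `w` lies in the subtree at `v`: `w` is `v` or a descendant of `v`. -/
def InSubtree (v w : Fin (n + 1)) : Prop := ∃ k : ℕ, F.parent^[k] w = v

/-- `w` is a (proper) descendant of `v`. -/
def IsDescendant (v w : Fin (n + 1)) : Prop := w ≠ v ∧ F.InSubtree v w

/-- `v` is a child of the root `0`. -/
def IsChildOfZero (v : Fin (n + 1)) : Prop := v ≠ 0 ∧ F.parent v = 0

/-- At least one descendant of `v` is smaller than `v`. -/
def InversionInitiating (v : Fin (n + 1)) : Prop := ∃ w, F.IsDescendant v w ∧ w < v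

/-- Not inversion-initiating. -/
def Regular (v : Fin (n + 1)) : Prop := ¬ F.InversionInitiating v

/-- The pair-count is `0` and all children of `0` are regular. -/
def Special : Prop := F.pairCount = 0 ∧ ∀ v, F.IsChildOfZero v → F.Regular v

/-- The graph on `{1, …, n}` obtained by forgetting the roots and deleting the vertex `0`; the
element `i` of `Fin n` stands for the vertex `i.succ`. -/
def deleteZero : SimpleGraph (Fin n) :=
  SimpleGraph.fromRel fun i j => F.parent i.succ = j.succ

/-- The vertices of all trees other than the one rooted at `0`. -/
def pairedVertices : Set (Fin (n + 1)) := {w | ¬ F.InSubtree 0 w}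

/-- The descendants of the inversion-initiating children of `0`. -/
def inversionVertices : Set (Fin (n + 1)) :=
  {w | ∃ c, F.IsChildOfZero c ∧ F.InversionInitiating c ∧ F.IsDescendant c w}

/-- `G` arises from `F` by joining the pair of trees that contains the smallest paired vertex `a`,
where `a` is smaller than all inversion vertices: if `u` is the root of the tree of `a` and `v` is
the other root of the pair, then the edges `0 v` and `v u` are added. -/
def JoinsTo (F G : PPRForest n) : Prop :=
  ∃ a u v, IsLeast F.pairedVertices a ∧ (∀ b ∈ F.inversionVertices, a < b) ∧
    F.parent u = u ∧ F.InSubtree u a ∧ F.mate u = v ∧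
    G.parent = Function.update (Function.update F.parent v 0) u v ∧
    G.mate = Function.update (Function.update F.mate u u) v v

/-- `G` arises from `F` by splitting off a pair of trees at the smallest inversion vertex `a`,
where `a` is smaller than all paired vertices: if `v` is the child of `0` of which `a` is a
descendant and `u` is the child of `v` on the path from `v` to `a`, then the edges `0 v` and `v u`
are deleted, and the resulting trees rooted at `u` and `v` form a new pair. -/
def SplitsTo (F G : PPRForest n) : Prop :=
  ∃ a u v, IsLeast F.inversionVertices a ∧ (∀ b ∈ F.pairedVertices, a < b) ∧
    F.IsChildOfZero v ∧ F.IsDescendant v a ∧ F.parent u = v ∧ F.InSubtree u a ∧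
    G.parent = Function.update (Function.update F.parent v v) u u ∧
    G.mate = Function.update (Function.update F.mate u v) v u

end PPRForest

/-!
Forests of unrooted trees are counted by a cancellation among signed, partially-paired rooted
forests.

*Cancellation.* Joining a pair of trees with roots `u` and `v` to the tree at `0`, by the edges
`0 v` and `v u`, lowers the pair-count by one and can be undone once the edges are known; the
relation between the two forests is `PPRForest.Linked`. The choice of the pair or of the edges is
governed by the smallest vertex `a` among the paired vertices and the inversion vertices. After a
join, `a` is a descendant of the child `v` of `0`, and `a < v` because `a` was the smallest paired
vertex, so `v` is inversion-initiating and `a` is the smallest inversion vertex. Hence the forest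
obtained is split at the same vertex, and the same holds in the other direction
(`PPRForest.joinsTo_iff_splitsTo`). The resulting involution is weight-reversing and defined
exactly on the forests that are not special.

*Special forests.* Deleting `0` from any forest leaves an acyclic graph, since the edge from a
vertex to its parent is a bridge. In a special forest there are no pairs, and the children of `0`
are the minima of the connected components left; so the unrooted forest determines the roots, and
then the parents, by induction on the distance from `0`. Conversely every unrooted forest is rooted
at the minima of its components (`PPRForest.bijOn_deleteZero`).

*Total weight.* A forest with pair-count `j` is given by its `2 j` paired roots, a perfect matching
of them, and a rooted forest with these roots and `0`. The number of rooted forests with a given set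
of `r` roots and `s` other vertices is `r (r + s) ^ (s - 1)` (`card_forestMaps_mul`), by induction
on `s`: deleting the roots leaves a rooted forest whose roots are their children, and the sum over
the possible sets of children is the derivative of the binomial theorem.
-/

/-! ### Iterating the parent map -/

namespace PPRForest

variable {n : ℕ} {F G : PPRForest n} {u v w x y : Fin (n + 1)}

theorem InSubtree.refl (F : PPRForest n) (v : Fin (n + 1)) : F.InSubtree v v := ⟨0, rfl⟩

theorem InSubtree.of_parent (h : F.InSubtree v (F.parent w)) : F.InSubtree v w := by
  obtain ⟨k, hk⟩ := h
  exact ⟨k + 1, by rwa [Function.iterate_succ_apply]⟩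

/-- Induction up the path from a vertex to one of its ancestors. -/
theorem InSubtree.induction {P : Fin (n + 1) → Prop} (h : F.InSubtree v w) (base : P v)
    (step : ∀ x, x ≠ v → F.InSubtree v (F.parent x) → P (F.parent x) → P x) : P w := by
  obtain ⟨k, hk⟩ := h
  induction k generalizing w with
  | zero =>
    obtain rfl : w = v := hk
    exact base
  | succ k ih =>
    rw [Function.iterate_succ_apply] at hk
    by_cases hw : w = v
    · exact hw ▸ base
    · exact step w hw ⟨k, hk⟩ (ih hk)

theorem InSubtree.parent_of_ne (h : F.InSubtree v w) (hw : w ≠ v) :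
    F.InSubtree v (F.parent w) := by
  obtain ⟨_ | k, hk⟩ := h
  · exact absurd hk hw
  · exact ⟨k, by rwa [Function.iterate_succ_apply] at hk⟩

theorem InSubtree.trans (h : F.InSubtree v w) (h' : F.InSubtree w x) : F.InSubtree v x :=
  h'.induction h fun _ _ _ => InSubtree.of_parent

/-- Two ancestors of the same vertex are comparable. -/
theorem InSubtree.total (h : F.InSubtree v x) (h' : F.InSubtree w x) :
    F.InSubtree v w ∨ F.InSubtree w v := by
  obtain ⟨k, rfl⟩ := h
  obtain ⟨l, rfl⟩ := h'
  rcases le_total k l with hkl | hkl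
  · exact Or.inr ⟨l - k, by rw [← Function.iterate_add_apply, Nat.sub_add_cancel hkl]⟩
  · exact Or.inl ⟨k - l, by rw [← Function.iterate_add_apply, Nat.sub_add_cancel hkl]⟩

theorem InSubtree.eq_of_parent_eq (h : F.InSubtree v w) (hw : F.parent w = w) : v = w := by
  obtain ⟨k, hk⟩ := h
  rw [← hk, Function.iterate_fixed hw]

theorem exists_root_inSubtree (F : PPRForest n) (w : Fin (n + 1)) :
    ∃ r, F.parent r = r ∧ F.InSubtree r w := by
  obtain ⟨k, hk⟩ := F.exists_root w
  exact ⟨_, hk, k, rfl⟩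

theorem root_unique (hv : F.parent v = v) (hw : F.parent w = w) (h : F.InSubtree v x)
    (h' : F.InSubtree w x) : v = w := by
  rcases h.total h' with h | h
  · exact h.eq_of_parent_eq hw
  · exact (h.eq_of_parent_eq hv).symm

/-- The parent map has no cycles other than its fixed points. -/
theorem InSubtree.antisymm (h : F.InSubtree v w) (h' : F.InSubtree w v) : v = w := by
  by_contra hne
  obtain ⟨r, hr, hrw⟩ := F.exists_root_inSubtree w
  -- The descendants of the cycle through `v` and `w` never leave it, yet they reach a root.
  have key : F.InSubtree v r ∧ F.InSubtree w r := by
    obtain ⟨k, rfl⟩ := hrw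
    have : ∀ k, F.InSubtree v (F.parent^[k] w) ∧ F.InSubtree w (F.parent^[k] w) := by
      intro k
      induction k with
      | zero => exact ⟨h, .refl F w⟩
      | succ k ih =>
        rw [Function.iterate_succ_apply']
        generalize F.parent^[k] w = y at ih
        have h1 : F.InSubtree v (F.parent y) := by
          by_cases hy : y = v
          · have := (h'.parent_of_ne (Ne.intro hne))
            rw [hy]
            exact h.trans this
          · exact ih.1.parent_of_ne hy
        exact ⟨h1, h'.trans h1⟩
    exact this k
  exact hne ((key.1.eq_of_parent_eq hr).trans (key.2.eq_of_parent_eq hr).symm)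

theorem not_inSubtree_parent (hv : F.parent v ≠ v) : ¬ F.InSubtree v (F.parent v) := fun h =>
  hv (h.antisymm (InSubtree.of_parent (.refl F _))).symm

/-- Every vertex other than `0` of the tree rooted at `0` lies in the subtree of a child of `0`. -/
theorem exists_isChildOfZero (h : F.InSubtree 0 w) (hw : w ≠ 0) :
    ∃ c, F.IsChildOfZero c ∧ F.InSubtree c w := by
  have : w ≠ 0 → ∃ c, F.IsChildOfZero c ∧ F.InSubtree c w := by
    refine InSubtree.induction (P := fun x => x ≠ 0 → ∃ c, F.IsChildOfZero c ∧ F.InSubtree c x) h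
      (fun h => absurd rfl h) fun x hx _ ih _ => ?_
    by_cases hp : F.parent x = 0
    · exact ⟨x, ⟨hx, hp⟩, .refl F x⟩
    · obtain ⟨c, hc, hcx⟩ := ih hp
      exact ⟨c, hc, hcx.of_parent⟩
  exact this hw

/-- Distinct vertices with the same parent have disjoint subtrees. -/
theorem sibling_unique (hv : F.parent v ≠ v) (hw : F.parent w ≠ w)
    (hvw : F.parent v = F.parent w) (h : F.InSubtree v x) (h' : F.InSubtree w x) : v = w := by
  by_contra hne
  rcases h.total h' with h | h
  · exact not_inSubtree_parent hv (hvw ▸ h.parent_of_ne (Ne.symm hne))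
  · exact not_inSubtree_parent hw (hvw ▸ h.parent_of_ne hne)

theorem IsChildOfZero.parent_ne (h : F.IsChildOfZero v) : F.parent v ≠ v := by
  rw [h.2]; exact h.1.symm

theorem IsChildOfZero.inSubtree_zero (h : F.IsChildOfZero v) (h' : F.InSubtree v w) :
    F.InSubtree 0 w :=
  (InSubtree.of_parent (by rw [h.2]; exact .refl F 0)).trans h'

theorem IsChildOfZero.eq_of_inSubtree (hv : F.IsChildOfZero v) (hw : F.IsChildOfZero w)
    (h : F.InSubtree v x) (h' : F.InSubtree w x) : v = w :=
  sibling_unique hv.parent_ne hw.parent_ne (hv.2.trans hw.2.symm) h h'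

theorem not_inSubtree_zero_of_root (hv : F.parent v = v) (hv0 : v ≠ 0) (h : F.InSubtree v w) :
    ¬ F.InSubtree 0 w := fun h0 => hv0 (root_unique hv F.parent_zero h h0)

theorem mate_ne_of_root (hv : F.parent v = v) (hv0 : v ≠ 0) : F.mate v ≠ v :=
  (F.mate_ne_iff v).2 ⟨hv0, hv⟩

/-! ### Joining and splitting -/

/-- `F` has the pair of trees with roots `u` and `v`, and `G` arises from `F` by removing this pair
and adding the edges `0 v` and `v u`; equivalently, `F` arises from `G` by splitting off the
pair. -/
structure Linked (F G : PPRForest n) (u v : Fin (n + 1)) : Prop where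
  ne : u ≠ v
  left_ne_zero : u ≠ 0
  right_ne_zero : v ≠ 0
  parent_left : F.parent u = u
  parent_right : F.parent v = v
  parent_left' : G.parent u = v
  parent_right' : G.parent v = 0
  parent_eq : ∀ w, w ≠ u → w ≠ v → F.parent w = G.parent w
  mate_left : F.mate u = v
  mate_right : F.mate v = u
  mate_left' : G.mate u = u
  mate_right' : G.mate v = v
  mate_eq : ∀ w, w ≠ u → w ≠ v → F.mate w = G.mate w

namespace Linked

variable {a b c : Fin (n + 1)} (h : Linked F G u v)

include h

theorem inSubtree (hx : F.InSubtree x w) : G.InSubtree x w := by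
  refine hx.induction (.refl G x) fun y hy hxy ih => .of_parent ?_
  have key : ∀ r, F.parent r = r → y ≠ r := by
    rintro r hr rfl
    exact hy ((hr ▸ hxy).eq_of_parent_eq hr).symm
  rwa [← h.parent_eq y (key u h.parent_left) (key v h.parent_right)]

theorem isChildOfZero : G.IsChildOfZero v := ⟨h.right_ne_zero, h.parent_right'⟩

theorem inSubtree_right : G.InSubtree v u :=
  .of_parent (by rw [h.parent_left']; exact .refl G v)

/-- The subtree at `c` changes only if `c` is `0` or `v`. -/
theorem inSubtree' (hx : G.InSubtree c w) (hc0 : c ≠ 0) (hcv : c ≠ v) : F.InSubtree c w := by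
  refine hx.induction (.refl F c) fun y hy hcy ih => .of_parent ?_
  rw [h.parent_eq]
  · exact ih
  · rintro rfl
    rw [h.parent_left'] at hcy
    have := hcy.parent_of_ne hcv.symm
    rw [h.parent_right'] at this
    exact hc0 (this.eq_of_parent_eq G.parent_zero)
  · rintro rfl
    rw [h.parent_right'] at hcy
    exact hc0 (hcy.eq_of_parent_eq G.parent_zero)

theorem inSubtree_right_iff : G.InSubtree v w ↔ F.InSubtree u w ∨ F.InSubtree v w := by
  constructor
  · intro hw
    refine InSubtree.induction (P := fun w => F.InSubtree u w ∨ F.InSubtree v w) hw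
      (.inr (.refl F v)) fun y hy _ ih => ?_
    by_cases hyu : y = u
    · exact .inl (hyu ▸ .refl F u)
    · rw [← h.parent_eq y hyu hy] at ih
      exact ih.imp .of_parent .of_parent
  · rintro (hw | hw)
    · exact h.inSubtree_right.trans (h.inSubtree hw)
    · exact h.inSubtree hw

theorem inSubtree_zero_iff : F.InSubtree 0 w ↔ G.InSubtree 0 w ∧ ¬ G.InSubtree v w := by
  constructor
  · refine fun hw => ⟨h.inSubtree hw, fun hvw => ?_⟩
    rcases h.inSubtree_right_iff.1 hvw with hr | hr
    · exact not_inSubtree_zero_of_root h.parent_left h.left_ne_zero hr hw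
    · exact not_inSubtree_zero_of_root h.parent_right h.right_ne_zero hr hw
  · rintro ⟨h0, hv⟩
    have : ¬ G.InSubtree v w → F.InSubtree 0 w := by
      refine InSubtree.induction (P := fun w => ¬ G.InSubtree v w → F.InSubtree 0 w) h0
        (fun _ => .refl F 0) fun y _ _ ih hvy => .of_parent ?_
      rw [h.parent_eq]
      · exact ih fun hp => hvy hp.of_parent
      · rintro rfl
        exact hvy h.inSubtree_right
      · rintro rfl
        exact hvy (.refl G _)
    exact this hv

theorem mem_pairedVertices_iff :
    w ∈ F.pairedVertices ↔ w ∈ G.pairedVertices ∨ G.InSubtree v w := by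
  change ¬ F.InSubtree 0 w ↔ ¬ G.InSubtree 0 w ∨ _
  rw [h.inSubtree_zero_iff]
  tauto

theorem isChildOfZero_iff (hc : c ≠ v) : F.IsChildOfZero c ↔ G.IsChildOfZero c := by
  by_cases hcu : c = u
  · subst hcu
    simp [IsChildOfZero, h.parent_left, h.parent_left', h.left_ne_zero, h.right_ne_zero]
  · rw [IsChildOfZero, IsChildOfZero, h.parent_eq c hcu hc]

theorem isDescendant_iff (hc0 : c ≠ 0) (hcv : c ≠ v) :
    F.IsDescendant c w ↔ G.IsDescendant c w :=
  and_congr_right fun _ => ⟨h.inSubtree, fun hw => h.inSubtree' hw hc0 hcv⟩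

theorem inversionVertices_subset (hb : b ∈ F.inversionVertices) : b ∈ G.inversionVertices := by
  obtain ⟨c, hc, ⟨w, hw, hwc⟩, hcb⟩ := hb
  have hcv : c ≠ v := by
    rintro rfl
    exact hc.parent_ne h.parent_right
  exact ⟨c, (h.isChildOfZero_iff hcv).1 hc, ⟨w, (h.isDescendant_iff hc.1 hcv).1 hw, hwc⟩,
    (h.isDescendant_iff hc.1 hcv).1 hcb⟩

theorem of_mem_inversionVertices (hb : b ∈ G.inversionVertices) :
    b ∈ F.inversionVertices ∨ G.IsDescendant v b := by
  obtain ⟨c, hc, ⟨w, hw, hwc⟩, hcb⟩ := hb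
  by_cases hcv : c = v
  · exact .inr (hcv ▸ hcb)
  · exact .inl ⟨c, (h.isChildOfZero_iff hcv).2 hc, ⟨w, (h.isDescendant_iff hc.1 hcv).2 hw, hwc⟩,
      (h.isDescendant_iff hc.1 hcv).2 hcb⟩

/-- The vertex `a` that selects the pair to be joined also selects the edges to be split. -/
theorem least_inversion_of_least_paired (ha : IsLeast F.pairedVertices a)
    (hab : ∀ b ∈ F.inversionVertices, a < b) (hua : F.InSubtree u a) :
    IsLeast G.inversionVertices a ∧ (∀ b ∈ G.pairedVertices, a < b) ∧ G.IsDescendant v a ∧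
      G.InSubtree u a := by
  have hva : G.InSubtree v a := h.inSubtree_right_iff.2 (.inl hua)
  have hav : a ≠ v := by
    rintro rfl
    exact h.ne (hua.eq_of_parent_eq h.parent_right)
  have hlt : a < v := lt_of_le_of_ne (ha.2 (h.mem_pairedVertices_iff.2 (.inr (.refl G v)))) hav
  refine ⟨⟨⟨v, h.isChildOfZero, ⟨a, ⟨hav, hva⟩, hlt⟩, hav, hva⟩, fun b hb => ?_⟩,
    fun b hb => ?_, ⟨hav, hva⟩, h.inSubtree hua⟩
  · rcases h.of_mem_inversionVertices hb with hb | hb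
    · exact (hab b hb).le
    · exact ha.2 (h.mem_pairedVertices_iff.2 (.inr hb.2))
  · refine lt_of_le_of_ne (ha.2 (h.mem_pairedVertices_iff.2 (.inl hb))) ?_
    rintro rfl
    exact hb (h.isChildOfZero.inSubtree_zero hva)

/-- The vertex `a` that selects the edges to be split also selects the pair to be joined. -/
theorem least_paired_of_least_inversion (ha : IsLeast G.inversionVertices a)
    (hab : ∀ b ∈ G.pairedVertices, a < b) (hva : G.IsDescendant v a) (hua : G.InSubtree u a) :
    IsLeast F.pairedVertices a ∧ (∀ b ∈ F.inversionVertices, a < b) ∧ F.InSubtree u a := by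
  obtain ⟨c, hc, hinv, hca⟩ := ha.1
  obtain rfl : c = v := hc.eq_of_inSubtree h.isChildOfZero hca.2 hva.2
  have hac : a < c := by
    obtain ⟨w, hw, hwc⟩ := hinv
    exact (ha.2 ⟨c, hc, ⟨w, hw, hwc⟩, hw⟩).trans_lt hwc
  refine ⟨⟨h.mem_pairedVertices_iff.2 (.inr hva.2), fun b hb => ?_⟩, fun b hb => ?_,
    h.inSubtree' hua h.left_ne_zero h.ne⟩
  · rcases h.mem_pairedVertices_iff.1 hb with hb | hb
    · exact (hab b hb).le
    · by_cases hbc : b = c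
      · exact hbc ▸ hac.le
      · exact ha.2 ⟨c, hc, hinv, hbc, hb⟩
  · refine lt_of_le_of_ne (ha.2 (h.inversionVertices_subset hb)) ?_
    rintro rfl
    obtain ⟨d, hd, -, hda⟩ := hb
    exact h.mem_pairedVertices_iff.2 (.inr hva.2) (hd.inSubtree_zero hda.2)

theorem eq_update_parent :
    G.parent = Function.update (Function.update F.parent v 0) u v := by
  funext w
  by_cases hu : w = u
  · subst hu; simp [h.parent_left']
  · by_cases hv : w = v
    · subst hv; simp [hu, h.parent_right']
    · simp [hu, hv, h.parent_eq]

theorem eq_update_mate : G.mate = Function.update (Function.update F.mate u u) v v := by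
  funext w
  by_cases hv : w = v
  · subst hv; simp [h.mate_right']
  · by_cases hu : w = u
    · subst hu; simp [hv, h.mate_left']
    · simp [hu, hv, h.mate_eq]

theorem eq_update_parent' :
    F.parent = Function.update (Function.update G.parent v v) u u := by
  funext w
  by_cases hu : w = u
  · subst hu; simp [h.parent_left]
  · by_cases hv : w = v
    · subst hv; simp [hu, h.parent_right]
    · simp [hu, hv, h.parent_eq]

theorem eq_update_mate' : F.mate = Function.update (Function.update G.mate u v) v u := by
  funext w
  by_cases hv : w = v
  · subst hv; simp [h.mate_right]
  · by_cases hu : w = u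
    · subst hu; simp [hv, h.mate_left]
    · simp [hu, hv, h.mate_eq]

end Linked

/-- In `JoinsTo` the roots `u` and `v` are automatically distinct from each other and from `0`. -/
theorem joinsTo_iff : F.JoinsTo G ↔ ∃ a u v, Linked F G u v ∧ IsLeast F.pairedVertices a ∧
    (∀ b ∈ F.inversionVertices, a < b) ∧ F.InSubtree u a := by
  constructor
  · rintro ⟨a, u, v, ha, hab, hu, hua, huv, hp, hm⟩
    have hu0 : u ≠ 0 := by
      rintro rfl
      exact ha.1 hua
    have hne : v ≠ u := huv ▸ mate_ne_of_root hu hu0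
    have hvu : F.mate v = u := huv ▸ F.mate_mate u
    have hv := (F.mate_ne_iff v).1 (by rw [hvu]; exact hne.symm)
    refine ⟨a, u, v, ⟨hne.symm, hu0, hv.1, hu, hv.2, ?_, ?_, ?_, huv, hvu, ?_, ?_, ?_⟩,
      ha, hab, hua⟩
    · simp [hp]
    · simp [hp, hne]
    · intro w hwu hwv
      simp [hp, hwu, hwv]
    · simp [hm, hne.symm]
    · simp [hm]
    · intro w hwu hwv
      simp [hm, hwu, hwv]
  · rintro ⟨a, u, v, h, ha, hab, hua⟩
    exact ⟨a, u, v, ha, hab, h.parent_left, hua, h.mate_left, h.eq_update_parent,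
      h.eq_update_mate⟩

theorem splitsTo_iff : G.SplitsTo F ↔ ∃ a u v, Linked F G u v ∧ IsLeast G.inversionVertices a ∧
    (∀ b ∈ G.pairedVertices, a < b) ∧ G.IsDescendant v a ∧ G.InSubtree u a := by
  constructor
  · rintro ⟨a, u, v, ha, hab, hv, hva, hu, hua, hp, hm⟩
    have hne : u ≠ v := by
      rintro rfl
      exact hv.parent_ne hu
    have hu0 : u ≠ 0 := by
      rintro rfl
      exact hv.1 (hu.symm.trans G.parent_zero)
    have hmate : ∀ w, G.parent w ≠ w → G.mate w = w := fun w hw => by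
      by_contra hc
      exact hw ((G.mate_ne_iff w).1 hc).2
    refine ⟨a, u, v, ⟨hne, hu0, hv.1, ?_, ?_, hu, hv.2, ?_, ?_, ?_,
      hmate u (by rw [hu]; exact hne.symm), hmate v hv.parent_ne, ?_⟩, ha, hab, hva, hua⟩
    · simp [hp]
    · simp [hp, hne.symm]
    · intro w hwu hwv
      simp [hp, hwu, hwv]
    · simp [hm, hne]
    · simp [hm]
    · intro w hwu hwv
      simp [hm, hwu, hwv]
  · rintro ⟨a, u, v, h, ha, hab, hva, hua⟩
    exact ⟨a, u, v, ha, hab, h.isChildOfZero, hva, h.parent_left', hua, h.eq_update_parent',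
      h.eq_update_mate'⟩

theorem joinsTo_iff_splitsTo : F.JoinsTo G ↔ G.SplitsTo F := by
  rw [joinsTo_iff, splitsTo_iff]
  constructor
  · rintro ⟨a, u, v, h, ha, hab, hua⟩
    exact ⟨a, u, v, h, h.least_inversion_of_least_paired ha hab hua⟩
  · rintro ⟨a, u, v, h, ha, hab, hva, hua⟩
    exact ⟨a, u, v, h, h.least_paired_of_least_inversion ha hab hva hua⟩

theorem JoinsTo.unique {G' : PPRForest n} (h : F.JoinsTo G) (h' : F.JoinsTo G') : G = G' := by
  obtain ⟨a, u, v, ha, -, hu, hua, huv, hp, hm⟩ := h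
  obtain ⟨a', u', v', ha', -, hu', hua', huv', hp', hm'⟩ := h'
  obtain rfl := ha.unique ha'
  obtain rfl := root_unique hu hu' hua hua'
  obtain rfl := huv.symm.trans huv'
  exact PPRForest.ext (hp.trans hp'.symm) (hm.trans hm'.symm)

theorem SplitsTo.unique {G' : PPRForest n} (h : F.SplitsTo G) (h' : F.SplitsTo G') : G = G' := by
  obtain ⟨a, u, v, ha, -, hv, hva, hu, hua, hp, hm⟩ := h
  obtain ⟨a', u', v', ha', -, hv', hva', hu', hua', hp', hm'⟩ := h'
  obtain rfl := ha.unique ha'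
  obtain rfl := hv.eq_of_inSubtree hv' hva.2 hva'.2
  have hne : ∀ w, F.parent w = v → F.parent w ≠ w := by
    rintro w hw hw'
    obtain rfl := hw'.symm.trans hw
    exact hv.parent_ne hw
  obtain rfl := sibling_unique (hne u hu) (hne u' hu') (hu.trans hu'.symm) hua hua'
  exact PPRForest.ext (hp.trans hp'.symm) (hm.trans hm'.symm)

theorem JoinsTo.not_splitsTo {G' : PPRForest n} (h : F.JoinsTo G) (h' : F.SplitsTo G') : False := by
  obtain ⟨a, u, v, ha, hab, -⟩ := h
  obtain ⟨a', u', v', ha', hab', -⟩ := h'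
  exact lt_asymm (hab a' ha'.1) (hab' a ha.1)

/-! ### Existence of joins and splits -/

theorem exists_isDescendant_child (h : F.IsDescendant v w) :
    ∃ u, F.parent u = v ∧ F.InSubtree u w := by
  have : w ≠ v → ∃ u, F.parent u = v ∧ F.InSubtree u w := by
    refine InSubtree.induction (P := fun x => x ≠ v → ∃ u, F.parent u = v ∧ F.InSubtree u x) h.2
      (fun h => absurd rfl h) fun x hx _ ih _ => ?_
    by_cases hp : F.parent x = v
    · exact ⟨x, hp, .refl F x⟩
    · obtain ⟨c, hc, hcx⟩ := ih hp
      exact ⟨c, hc, hcx.of_parent⟩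
  exact this h.1

/-- Every vertex reaches a fixed point of `p`, if this holds for the roots and for the vertices at
which `p` differs from the parent map. -/
theorem exists_root_of_step {p : Fin (n + 1) → Fin (n + 1)} (F : PPRForest n)
    (hp : ∀ w, (∃ k, p (p^[k] w) = p^[k] w) ∨ F.parent w = p w ∧ F.parent w ≠ w)
    (w : Fin (n + 1)) : ∃ k, p (p^[k] w) = p^[k] w := by
  obtain ⟨r, hr, hrw⟩ := F.exists_root_inSubtree w
  refine InSubtree.induction (P := fun w => ∃ k, p (p^[k] w) = p^[k] w) hrw ?_ fun x _ _ ih => ?_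
  · exact (hp r).resolve_right fun h => h.2 hr
  · rcases hp x with h | h
    · exact h
    · obtain ⟨k, hk⟩ := h.1 ▸ ih
      exact ⟨k + 1, by rwa [Function.iterate_succ_apply]⟩

theorem exists_joinsTo {a : Fin (n + 1)} (ha : IsLeast F.pairedVertices a)
    (hab : ∀ b ∈ F.inversionVertices, a < b) : ∃ G, F.JoinsTo G := by
  obtain ⟨u, hu, hua⟩ := F.exists_root_inSubtree a
  have hu0 : u ≠ 0 := by
    rintro rfl
    exact ha.1 hua
  obtain ⟨v, huv⟩ : ∃ v, F.mate u = v := ⟨_, rfl⟩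
  have hne : v ≠ u := huv ▸ mate_ne_of_root hu hu0
  have hvu : F.mate v = u := huv ▸ F.mate_mate u
  have hv := (F.mate_ne_iff v).1 (by rw [hvu]; exact hne.symm)
  have hmate : ∀ w, w ≠ u → w ≠ v → F.mate w ≠ u ∧ F.mate w ≠ v := fun w hwu hwv =>
    ⟨fun h => hwv (by rw [← huv, ← h, F.mate_mate]), fun h => hwu (by rw [← hvu, ← h, F.mate_mate])⟩
  have e0 : Function.update (Function.update F.parent v 0) u v 0 = 0 := by
    simp [hu0.symm, hv.1.symm, F.parent_zero]
  have ev : Function.update (Function.update F.parent v 0) u v v = 0 := by simp [hne]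
  have eu : Function.update (Function.update F.parent v 0) u v u = v := by simp
  refine ⟨⟨Function.update (Function.update F.parent v 0) u v, e0,
    F.exists_root_of_step fun w => ?_, Function.update (Function.update F.mate u u) v v,
    fun w => ?_, fun w => ?_⟩, a, u, v, ha, hab, hu, hua, huv, rfl, rfl⟩
  -- The new path from `u` to the root `0` runs through `v`.
  · by_cases hwu : w = u
    · subst hwu
      exact .inl ⟨2, by
        simp only [Function.iterate_succ_apply, Function.iterate_zero, id, eu, ev, e0]⟩
    by_cases hwv : w = v
    · subst hwv
      exact .inl ⟨1, by simp only [Function.iterate_succ_apply, Function.iterate_zero, id, ev, e0]⟩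
    by_cases hw : F.parent w = w
    · exact .inl ⟨0, by simp [hwu, hwv, hw]⟩
    · exact .inr ⟨by simp [hwu, hwv], hw⟩
  · by_cases hwv : w = v
    · subst hwv; simp
    by_cases hwu : w = u
    · subst hwu; simp [hwv]
    simp [hwu, hwv, hmate w hwu hwv, F.mate_mate]
  · by_cases hwv : w = v
    · subst hwv; simp [hne, hv.1.symm]
    by_cases hwu : w = u
    · subst hwu; simp [hwv, hne]
    simpa [hwu, hwv] using F.mate_ne_iff w

theorem exists_splitsTo {a : Fin (n + 1)} (ha : IsLeast F.inversionVertices a)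
    (hab : ∀ b ∈ F.pairedVertices, a < b) : ∃ G, F.SplitsTo G := by
  obtain ⟨v, hv, hinv, hva⟩ := ha.1
  obtain ⟨u, hu, hua⟩ := exists_isDescendant_child hva
  have hne : u ≠ v := by
    rintro rfl
    exact hv.parent_ne hu
  have hu0 : u ≠ 0 := by
    rintro rfl
    exact hv.1 (hu.symm.trans F.parent_zero)
  have hfix : ∀ w, F.parent w ≠ w → F.mate w = w := fun w hw => by
    by_contra hc
    exact hw ((F.mate_ne_iff w).1 hc).2
  have hmu : F.mate u = u := hfix u (by rw [hu]; exact hne.symm)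
  have hmv : F.mate v = v := hfix v hv.parent_ne
  have hmate : ∀ w, w ≠ u → w ≠ v → F.mate w ≠ u ∧ F.mate w ≠ v := fun w hwu hwv =>
    ⟨fun h => hwu (by rw [← F.mate_mate w, h, hmu]), fun h => hwv (by rw [← F.mate_mate w, h, hmv])⟩
  refine ⟨⟨Function.update (Function.update F.parent v v) u u, ?_,
    F.exists_root_of_step fun w => ?_, Function.update (Function.update F.mate u v) v u,
    fun w => ?_, fun w => ?_⟩, a, u, v, ha, hab, hv, hva, hu, hua, rfl, rfl⟩
  · simp [hu0.symm, hv.1.symm, F.parent_zero]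
  · by_cases hwu : w = u
    · subst hwu
      exact .inl ⟨0, by simp⟩
    by_cases hwv : w = v
    · subst hwv
      exact .inl ⟨0, by simp [hwu]⟩
    by_cases hw : F.parent w = w
    · exact .inl ⟨0, by simp [hwu, hwv, hw]⟩
    · exact .inr ⟨by simp [hwu, hwv], hw⟩
  · by_cases hwv : w = v
    · subst hwv; simp [hne]
    by_cases hwu : w = u
    · subst hwu; simp [hwv]
    simp [hwu, hwv, hmate w hwu hwv, F.mate_mate]
  · by_cases hwv : w = v
    · subst hwv; simp [hne, hne.symm, hv.1]
    by_cases hwu : w = u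
    · subst hwu; simp [hwv, hne.symm, hu0]
    simpa [hwu, hwv] using F.mate_ne_iff w

/-! ### The pair-count -/

/-- Every pair contributes two roots. -/
theorem two_mul_pairCount (F : PPRForest n) :
    2 * F.pairCount = (Finset.univ.filter fun v => F.mate v ≠ v).card := by
  have h1 : (Finset.univ.filter fun v => F.mate v ≠ v) =
      (Finset.univ.filter fun v => v < F.mate v) ∪ (Finset.univ.filter fun v => F.mate v < v) := by
    ext v
    simp only [Finset.mem_filter, Finset.mem_univ, true_and, Finset.mem_union]
    rw [ne_comm]
    exact ne_iff_lt_or_gt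
  have h2 : (Finset.univ.filter fun v => F.mate v < v).card = F.pairCount := by
    refine Finset.card_bij' (fun v _ => F.mate v) (fun v _ => F.mate v) ?_ ?_ ?_ ?_ <;>
      simp [F.mate_mate]
  rw [h1, Finset.card_union_of_disjoint, h2, two_mul, pairCount]
  rw [Finset.disjoint_filter]
  exact fun v _ => lt_asymm

theorem pairCount_eq_zero_iff : F.pairCount = 0 ↔ ∀ v, F.parent v = v → v = 0 := by
  have : F.pairCount = 0 ↔ 2 * F.pairCount = 0 := by omega
  rw [this, two_mul_pairCount, Finset.card_eq_zero, Finset.filter_eq_empty_iff]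
  simp only [Finset.mem_univ, forall_const, F.mate_ne_iff]
  exact forall_congr' fun v => by tauto

theorem Linked.pairCount_eq (h : Linked F G u v) : F.pairCount = G.pairCount + 1 := by
  have key : (Finset.univ.filter fun v => F.mate v ≠ v) =
      insert u (insert v (Finset.univ.filter fun v => G.mate v ≠ v)) := by
    ext w
    simp only [Finset.mem_filter, Finset.mem_univ, true_and, Finset.mem_insert]
    by_cases hwu : w = u
    · subst hwu; simp [h.mate_left, h.ne.symm]
    by_cases hwv : w = v
    · subst hwv; simp [h.mate_right, h.ne]
    simp [hwu, hwv, h.mate_eq]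
  have hF := F.two_mul_pairCount
  rw [key, Finset.card_insert_of_notMem (by simp [h.ne, h.mate_left']),
    Finset.card_insert_of_notMem (by simp [h.mate_right']), ← two_mul_pairCount] at hF
  omega

theorem JoinsTo.weight_eq (h : F.JoinsTo G) : G.weight = -F.weight := by
  obtain ⟨a, u, v, h, -⟩ := joinsTo_iff.1 h
  rw [weight, weight, h.pairCount_eq, pow_succ]
  ring

/-- A forest is special exactly if there is no vertex at which it could be joined or split. -/
theorem special_iff :
    F.Special ↔ F.pairedVertices = ∅ ∧ F.inversionVertices = ∅ := by
  refine and_congr ?_ ?_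
  · rw [pairCount_eq_zero_iff, Set.eq_empty_iff_forall_notMem]
    constructor
    · intro h w hw
      obtain ⟨r, hr, hrw⟩ := F.exists_root_inSubtree w
      exact hw (h r hr ▸ hrw)
    · intro h v hv
      exact (not_not.1 (h v)).eq_of_parent_eq hv |>.symm
  · rw [Set.eq_empty_iff_forall_notMem]
    constructor
    · rintro h w ⟨c, hc, hinv, -⟩
      exact h c hc hinv
    · rintro h c hc ⟨w, hw, hwc⟩
      exact h w ⟨c, hc, ⟨w, hw, hwc⟩, hw⟩

theorem exists_isLeast {s : Set (Fin (n + 1))} (hs : s.Nonempty) : ∃ a, IsLeast s a :=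
  ⟨_, wellFounded_lt.min_mem s hs, fun _ hb => not_lt.1 (wellFounded_lt.not_lt_min s hb)⟩

theorem exists_joinsTo_or_splitsTo (h : ¬ F.Special) :
    ∃ G, F.JoinsTo G ∨ F.SplitsTo G := by
  rw [special_iff, not_and_or, ← ne_eq, ← ne_eq, ← Set.nonempty_iff_ne_empty,
    ← Set.nonempty_iff_ne_empty] at h
  have hdisj : ∀ a ∈ F.pairedVertices, a ∉ F.inversionVertices := by
    rintro a ha ⟨c, hc, -, hca⟩
    exact ha (hc.inSubtree_zero hca.2)
  rcases F.pairedVertices.eq_empty_or_nonempty with hp | hp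
  · obtain ⟨a, ha⟩ := exists_isLeast (h.resolve_left (by simp [hp]))
    obtain ⟨G, hG⟩ := exists_splitsTo ha (by simp [hp])
    exact ⟨G, .inr hG⟩
  obtain ⟨a, ha⟩ := exists_isLeast hp
  rcases F.inversionVertices.eq_empty_or_nonempty with hi | hi
  · obtain ⟨G, hG⟩ := exists_joinsTo ha (by simp [hi])
    exact ⟨G, .inl hG⟩
  obtain ⟨b, hb⟩ := exists_isLeast hi
  rcases lt_trichotomy a b with hab | hab | hab
  · obtain ⟨G, hG⟩ := exists_joinsTo ha fun c hc => hab.trans_le (hb.2 hc)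
    exact ⟨G, .inl hG⟩
  · exact absurd hb.1 (hab ▸ hdisj a ha.1)
  · obtain ⟨G, hG⟩ := exists_splitsTo hb fun c hc => hab.trans_le (ha.2 hc)
    exact ⟨G, .inr hG⟩

theorem JoinsTo.not_special (h : F.JoinsTo G) : ¬ F.Special := by
  obtain ⟨a, -, -, ha, -⟩ := h
  intro hs
  simpa [(special_iff.1 hs).1] using ha.1

theorem SplitsTo.not_special (h : F.SplitsTo G) : ¬ F.Special := by
  obtain ⟨a, -, -, ha, -⟩ := h
  intro hs
  simpa [(special_iff.1 hs).2] using ha.1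

/-- Each forest that is not special can be joined or split in exactly one way, and the relation of
being obtained in this way is symmetric. -/
theorem exists_signReversing_involution (n : ℕ) :
    ∃ φ : {F : PPRForest n // ¬ F.Special} → {F : PPRForest n // ¬ F.Special},
      Function.Involutive φ ∧
      (∀ F : {F : PPRForest n // ¬ F.Special}, (φ F).1.weight = -F.1.weight) ∧
      ∀ F : {F : PPRForest n // ¬ F.Special}, F.1.JoinsTo (φ F).1 ∨ F.1.SplitsTo (φ F).1 := by
  have key : ∀ F : {F : PPRForest n // ¬ F.Special}, ∃ G : {F : PPRForest n // ¬ F.Special},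
      F.1.JoinsTo G.1 ∨ F.1.SplitsTo G.1 := by
    rintro ⟨F, hF⟩
    obtain ⟨G, hG⟩ := exists_joinsTo_or_splitsTo hF
    exact ⟨⟨G, hG.elim (fun h => (joinsTo_iff_splitsTo.1 h).not_special)
      fun h => (joinsTo_iff_splitsTo.2 h).not_special⟩, hG⟩
  choose φ hφ using key
  refine ⟨φ, fun F => Subtype.ext ?_, fun F => ?_, hφ⟩
  · rcases hφ F with h | h
    · have h' := joinsTo_iff_splitsTo.1 h
      exact ((hφ (φ F)).resolve_left fun h'' => h''.not_splitsTo h').unique h'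
    · have h' := joinsTo_iff_splitsTo.2 h
      exact ((hφ (φ F)).resolve_right fun h'' => h'.not_splitsTo h'').unique h'
  · rcases hφ F with h | h
    · exact h.weight_eq
    · have := (joinsTo_iff_splitsTo.2 h).weight_eq
      rw [this, neg_neg]

end PPRForest

/-! ### Special forests and unrooted forests -/

/-- A set of vertices that is closed under adjacency is closed under reachability. -/
theorem SimpleGraph.Reachable.mem_of_closed {V : Type*} {H : SimpleGraph V} {S : Set V} {u v : V}
    (hS : ∀ x ∈ S, ∀ y, H.Adj x y → y ∈ S) (h : H.Reachable u v) (hu : u ∈ S) : v ∈ S := by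
  obtain ⟨p⟩ := h
  induction p with
  | nil => exact hu
  | cons hadj _ ih => exact ih (hS _ hu _ hadj)

namespace PPRForest

variable {n : ℕ} {F G : PPRForest n} {i j : Fin n}

theorem deleteZero_adj : F.deleteZero.Adj i j ↔
    i ≠ j ∧ (F.parent i.succ = j.succ ∨ F.parent j.succ = i.succ) :=
  SimpleGraph.fromRel_adj _ _ _

/-- The edge from `i` to its parent is a bridge: without it, the subtree at `i` is closed under
adjacency. -/
theorem isBridge_of_parent_eq (hij : i ≠ j) (h : F.parent i.succ = j.succ) :
    F.deleteZero.IsBridge s(i, j) := by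
  rw [SimpleGraph.isBridge_iff]
  intro hr
  have hmem : j ∈ {x : Fin n | F.InSubtree i.succ x.succ} := by
    refine hr.mem_of_closed (fun x hx y hxy => ?_) (.refl F _)
    rw [SimpleGraph.deleteEdges_adj, deleteZero_adj] at hxy
    obtain ⟨⟨-, hxy | hxy⟩, hne⟩ := hxy
    · have hxi : x ≠ i := by
        rintro rfl
        exact hne (by rw [Fin.succ_injective _ (h.symm.trans hxy)]; rfl)
      have := hx.parent_of_ne fun h => hxi (Fin.succ_injective _ h)
      rwa [hxy] at this
    · exact InSubtree.of_parent (by rw [hxy]; exact hx)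
  refine not_inSubtree_parent (F := F) (v := i.succ) ?_ (by rw [h]; exact hmem)
  rw [h]
  exact fun h => hij (Fin.succ_injective _ h).symm

theorem isAcyclic_deleteZero (F : PPRForest n) : F.deleteZero.IsAcyclic := by
  rw [SimpleGraph.isAcyclic_iff_forall_adj_isBridge]
  intro i j hij
  obtain ⟨hne, h | h⟩ := deleteZero_adj.1 hij
  · exact isBridge_of_parent_eq hne h
  · rw [Sym2.eq_swap]
    exact isBridge_of_parent_eq hne.symm h

theorem Special.eq_zero_of_parent_eq (hF : F.Special) {v : Fin (n + 1)} (hv : F.parent v = v) :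
    v = 0 :=
  pairCount_eq_zero_iff.1 hF.1 v hv

theorem Special.inSubtree_zero (hF : F.Special) (v : Fin (n + 1)) : F.InSubtree 0 v := by
  obtain ⟨r, hr, hrv⟩ := F.exists_root_inSubtree v
  exact hF.eq_zero_of_parent_eq hr ▸ hrv

theorem Special.le_of_inSubtree (hF : F.Special) {v w : Fin (n + 1)} (hv : F.IsChildOfZero v)
    (h : F.InSubtree v w) : v ≤ w := by
  by_contra hlt
  rw [not_le] at hlt
  exact hF.2 v hv ⟨w, ⟨hlt.ne, h⟩, hlt⟩

/-- The trees at the children of `0` are unions of connected components. -/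
theorem IsChildOfZero.inSubtree_of_reachable (hi : F.IsChildOfZero i.succ)
    (h : F.deleteZero.Reachable i j) : F.InSubtree i.succ j.succ := by
  suffices hmem : j ∈ {x : Fin n | F.InSubtree i.succ x.succ} from hmem
  refine h.mem_of_closed (fun x hx y hxy => ?_) (.refl F _)
  rcases (deleteZero_adj.1 hxy).2 with hxy | hxy
  · have hxi : x.succ ≠ i.succ := fun hxi => by
      rw [hxi, hi.2] at hxy
      exact (Fin.succ_ne_zero y) hxy.symm
    have := hx.parent_of_ne hxi
    rwa [hxy] at this
  · exact InSubtree.of_parent (by rw [hxy]; exact hx)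

theorem reachable_of_inSubtree (h : F.InSubtree i.succ j.succ) : F.deleteZero.Reachable i j := by
  have : ∀ x : Fin n, j.succ = x.succ → F.deleteZero.Reachable i x := by
    refine InSubtree.induction
      (P := fun w => ∀ x : Fin n, w = x.succ → F.deleteZero.Reachable i x) h ?_ ?_
    · rintro x hx
      rw [Fin.succ_injective _ hx]
    · rintro _ hne hsub ih x rfl
      obtain ⟨y, hy⟩ : ∃ y : Fin n, F.parent x.succ = y.succ := by
        refine (Fin.exists_succ_eq.2 fun h0 => ?_).imp fun _ => Eq.symm
        rw [h0] at hsub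
        exact Fin.succ_ne_zero i (hsub.eq_of_parent_eq F.parent_zero)
      by_cases hxy : x = y
      · subst hxy
        exact absurd (hsub.trans (by rw [hy]; exact .refl F _) |>.eq_of_parent_eq hy).symm hne
      · exact (ih y hy).trans (SimpleGraph.Adj.reachable
          (deleteZero_adj.2 ⟨Ne.symm hxy, .inr hy⟩))
  exact this j rfl

/-- In a special forest the children of `0` are the minima of the connected components, so that
they are determined by the unrooted forest. -/
theorem Special.isChildOfZero_of_deleteZero_eq (hF : F.Special) (hG : G.Special)
    (h : F.deleteZero = G.deleteZero) {v : Fin (n + 1)} (hv : F.IsChildOfZero v) :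
    G.IsChildOfZero v := by
  obtain ⟨i, rfl⟩ := Fin.exists_succ_eq.2 hv.1
  obtain ⟨c, hc, hci⟩ := exists_isChildOfZero (hG.inSubtree_zero i.succ) hv.1
  obtain ⟨j, rfl⟩ := Fin.exists_succ_eq.2 hc.1
  have hij : F.deleteZero.Reachable i j := by
    rw [h]
    exact (reachable_of_inSubtree hci).symm
  rw [(hF.le_of_inSubtree hv (hv.inSubtree_of_reachable hij)).antisymm (hG.le_of_inSubtree hc hci)]
  exact hc

/-- The children of `0` are recovered from the unrooted forest by
`Special.isChildOfZero_of_deleteZero_eq`, and the other parents by induction along the path from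
`0`. -/
theorem injOn_deleteZero : Set.InjOn deleteZero {F : PPRForest n | F.Special} := by
  intro F hF G hG h
  have hparent : ∀ v, F.parent v = G.parent v := by
    intro v
    refine InSubtree.induction (P := fun v => F.parent v = G.parent v) (hF.inSubtree_zero v)
      (F.parent_zero.trans G.parent_zero.symm) fun v hv _ ih => ?_
    by_cases hp : F.parent v = 0
    · rw [hp, (hF.isChildOfZero_of_deleteZero_eq hG h ⟨hv, hp⟩).2]
    · obtain ⟨i, rfl⟩ := Fin.exists_succ_eq.2 hv
      obtain ⟨j, hj⟩ := Fin.exists_succ_eq.2 hp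
      have hne : F.parent i.succ ≠ i.succ := fun h => hv (hF.eq_zero_of_parent_eq h)
      have hij : i ≠ j := by
        rintro rfl
        exact hne hj.symm
      have hadj : G.deleteZero.Adj i j := h ▸ deleteZero_adj.2 ⟨hij, .inl hj.symm⟩
      rcases (deleteZero_adj.1 hadj).2 with h' | h'
      · rw [h', hj]
      · -- Otherwise `i` and `j` would be parents of each other in `F`.
        rw [← hj] at ih
        exact absurd (InSubtree.of_parent (by rw [← hj, ih, h']; exact .refl F _))
          (not_inSubtree_parent hne)
  have hmate : ∀ F : PPRForest n, F.Special → F.mate = id := by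
    intro F hF
    funext v
    by_contra hv
    have := (F.mate_ne_iff v).1 hv
    exact this.1 (hF.eq_zero_of_parent_eq this.2)
  exact PPRForest.ext (funext hparent) ((hmate F hF).trans (hmate G hG).symm)

/-- An unrooted forest becomes a special forest by rooting each tree at its minimum and joining
these roots to `0`. -/
theorem exists_special_of_isAcyclic {H : SimpleGraph (Fin n)} (hH : H.IsAcyclic) :
    ∃ F : PPRForest n, F.Special ∧ F.deleteZero = H := by
  have hmin : ∀ i, ∃ r, H.Reachable i r ∧ ∀ j, H.Reachable i j → r ≤ j := fun i =>
    ⟨_, wellFounded_lt.min_mem {j | H.Reachable i j} ⟨i, .refl i⟩,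
      fun _ hb => not_lt.1 (wellFounded_lt.not_lt_min {j | H.Reachable i j} hb)⟩
  choose r hr hrle using hmin
  have hreq : ∀ i j, H.Reachable i j → r i = r j := fun i j hij =>
    (hrle i _ (hij.trans (hr j))).antisymm (hrle j _ (hij.symm.trans (hr i)))
  have hpar : ∀ i, ∃ q : Fin (n + 1), (i = r i ∧ q = 0) ∨
      ∃ j, q = j.succ ∧ H.Adj i j ∧ H.dist j (r i) < H.dist i (r i) := by
    intro i
    by_cases hi : i = r i
    · exact ⟨0, .inl ⟨hi, rfl⟩⟩
    · obtain ⟨p, hp⟩ := (hr i).exists_walk_length_eq_dist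
      generalize r i = s at p hp hi
      cases p with
      | nil => exact absurd rfl hi
      | cons hadj p =>
        refine ⟨_, .inr ⟨_, rfl, hadj, ?_⟩⟩
        rw [← hp, SimpleGraph.Walk.length_cons]
        exact Nat.lt_succ_of_le (SimpleGraph.dist_le p)
  choose q hq using hpar
  obtain ⟨p, hp0, hps⟩ : ∃ p : Fin (n + 1) → Fin (n + 1), p 0 = 0 ∧ ∀ i : Fin n, p i.succ = q i :=
    ⟨Fin.cons 0 q, rfl, fun i => rfl⟩
  have hreach : ∀ d i, H.dist i (r i) = d → ∃ k, p^[k] i.succ = 0 := by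
    intro d
    induction d using Nat.strong_induction_on with
    | _ d ih =>
      intro i hi
      rcases hq i with ⟨-, h0⟩ | ⟨j, hj, hadj, hlt⟩
      · exact ⟨1, by rw [Function.iterate_one, hps, h0]⟩
      · obtain ⟨k, hk⟩ := ih _ (hi ▸ hlt) j (by rw [hreq i j hadj.reachable])
        exact ⟨k + 1, by rw [Function.iterate_succ_apply, hps, hj, hk]⟩
  have hne : ∀ i : Fin n, p i.succ ≠ i.succ := by
    intro i hi
    rcases hq i with ⟨-, h0⟩ | ⟨j, hj, hadj, -⟩
    · exact Fin.succ_ne_zero i (by rw [← hi, hps, h0])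
    · exact hadj.ne (Fin.succ_injective _ (by rw [← hj, ← hps, hi]))
  let F : PPRForest n :=
    { parent := p
      parent_zero := hp0
      exists_root := fun v => by
        induction v using Fin.cases with
        | zero => exact ⟨0, hp0⟩
        | succ i =>
          obtain ⟨k, hk⟩ := hreach _ i rfl
          exact ⟨k, by rw [hk, hp0]⟩
      mate := id
      mate_mate := fun _ => rfl
      mate_ne_iff := fun v => by
        induction v using Fin.cases with
        | zero => simp
        | succ i => simp [hne] }
  have hFp : ∀ i : Fin n, F.parent i.succ = q i := hps
  have hle : ∀ i j, F.deleteZero.Adj i j → H.Adj i j := by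
    intro i j hij
    have key : ∀ i j : Fin n, F.parent i.succ = j.succ → H.Adj i j := by
      intro i j hij
      rw [hFp] at hij
      rcases hq i with ⟨-, h0⟩ | ⟨k, hk, hadj, -⟩
      · exact absurd (hij.symm.trans h0) (Fin.succ_ne_zero j)
      · rwa [← Fin.succ_injective _ (hk.symm.trans hij)]
    exact (deleteZero_adj.1 hij).2.elim (key i j) fun h => (key j i h).symm
  have hspecial : F.Special := by
    refine ⟨pairCount_eq_zero_iff.2 fun v hv => ?_, fun c hc ⟨w, hw, hwc⟩ => ?_⟩
    · by_contra h0
      obtain ⟨i, rfl⟩ := Fin.exists_succ_eq.2 h0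
      exact hne i hv
    · obtain ⟨i, rfl⟩ := Fin.exists_succ_eq.2 hc.1
      have hw0 : w ≠ 0 := by
        rintro rfl
        exact hc.1 (hw.2.eq_of_parent_eq F.parent_zero)
      obtain ⟨j, rfl⟩ := Fin.exists_succ_eq.2 hw0
      have hi : i = r i := by
        rcases hq i with h | ⟨k, hk, -⟩
        · exact h.1
        · exact absurd (hk.symm.trans ((hFp i).symm.trans hc.2)) (Fin.succ_ne_zero k)
      have hij := (reachable_of_inSubtree hw.2).mono hle
      exact (Fin.succ_lt_succ_iff.1 hwc).not_ge (hi ▸ hrle i j hij)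
  -- The tree edges already connect each vertex to the minimum of its component.
  have hconn : ∀ i, F.deleteZero.Reachable (r i) i := by
    intro i
    obtain ⟨c, hc, hci⟩ :=
      exists_isChildOfZero (hspecial.inSubtree_zero i.succ) (Fin.succ_ne_zero i)
    obtain ⟨j, rfl⟩ := Fin.exists_succ_eq.2 hc.1
    have hji := reachable_of_inSubtree hci
    have hj : j = r j := by
      rcases hq j with h | ⟨k, hk, -⟩
      · exact h.1
      · exact absurd (hk.symm.trans ((hFp j).symm.trans hc.2)) (Fin.succ_ne_zero k)
    rwa [← hreq j i (hji.mono hle), ← hj]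
  refine ⟨F, hspecial, le_antisymm hle fun i j hij => ?_⟩
  -- An edge of `H` that is no tree edge would be bypassed by tree edges, and thus be no bridge.
  by_contra hF
  refine (SimpleGraph.isBridge_iff.1 (SimpleGraph.isAcyclic_iff_forall_adj_isBridge.1 hH hij)) ?_
  have hij' : F.deleteZero.Reachable i j :=
    (hconn i).symm.trans (hreq i j hij.reachable ▸ hconn j)
  refine hij'.mono fun x y hxy => ?_
  rw [SimpleGraph.deleteEdges_adj]
  refine ⟨hle x y hxy, fun he => ?_⟩
  rcases Sym2.eq_iff.1 (Set.mem_singleton_iff.1 he) with ⟨rfl, rfl⟩ | ⟨rfl, rfl⟩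
  · exact hF hxy
  · exact hF hxy.symm

theorem bijOn_deleteZero : Set.BijOn deleteZero {F : PPRForest n | F.Special}
    {G : SimpleGraph (Fin n) | G.IsAcyclic} :=
  ⟨fun F _ => F.isAcyclic_deleteZero, injOn_deleteZero, fun _ hH => exists_special_of_isAcyclic hH⟩

end PPRForest

/-! ### Counting rooted forests with given roots -/

section Counting

variable {V : Type*} [Fintype V] [DecidableEq V]

open Classical in
/-- The parent maps of the rooted forests with root set `R` and set of non-root vertices `S`,
extended to all of `V` by the identity. -/
noncomputable def forestMaps (S R : Finset V) : Finset (V → V) :=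
  Finset.univ.filter fun p => (∀ v ∉ S, p v = v) ∧ ∀ v ∈ S, ∃ k : ℕ, p^[k] v ∈ R

theorem mem_forestMaps {S R : Finset V} {p : V → V} : p ∈ forestMaps S R ↔
    (∀ v ∉ S, p v = v) ∧ ∀ v ∈ S, ∃ k : ℕ, p^[k] v ∈ R := by
  simp [forestMaps]

theorem forestMaps_empty_left (R : Finset V) : forestMaps ∅ R = {id} := by
  ext p
  simp [mem_forestMaps, funext_iff]

theorem forestMaps_empty_right {S : Finset V} (hS : S.Nonempty) : forestMaps S ∅ = ∅ := by
  obtain ⟨v, hv⟩ := hS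
  refine Finset.eq_empty_of_forall_notMem fun p hp => ?_
  obtain ⟨k, hk⟩ := (mem_forestMaps.1 hp).2 v hv
  exact Finset.notMem_empty _ hk

/-- A rooted forest in which `I` is the set of children of the roots consists of a map from `I` to
the roots and of the rooted forest with root set `I` that remains when the roots are deleted. -/
theorem card_forestMaps_fiber {S R I : Finset V} (hSR : Disjoint S R) (hI : I ⊆ S) :
    ((forestMaps S R).filter fun p => (S.filter fun v => p v ∈ R) = I).card =
      R.card ^ I.card * (forestMaps (S \ I) I).card := by
  have hpi : (Fintype.piFinset fun v => if v ∈ I then R else {v}).card = R.card ^ I.card := by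
    rw [Fintype.card_piFinset]
    simp only [apply_ite Finset.card, Finset.card_singleton]
    rw [Finset.prod_ite_mem, Finset.univ_inter, Finset.prod_const]
  rw [← hpi, ← Finset.card_product]
  refine Finset.card_nbij'
    (fun p => (fun v => if v ∈ I then p v else v, fun v => if v ∈ I then v else p v))
    (fun q v => if v ∈ I then q.1 v else q.2 v) ?_ ?_ ?_ ?_
  · intro p hp
    obtain ⟨hp, hpI⟩ := Finset.mem_filter.1 hp
    obtain ⟨hid, hreach⟩ := mem_forestMaps.1 hp
    refine Finset.mem_product.2 ⟨?_, mem_forestMaps.2 ⟨fun v hv => ?_, fun v hv => ?_⟩⟩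
    · rw [Fintype.mem_piFinset]
      intro v
      by_cases hv : v ∈ I
      · rw [← hpI, Finset.mem_filter] at hv
        simp [hpI ▸ Finset.mem_filter.2 hv, hv.2]
      · simp [hv]
    · by_cases hvI : v ∈ I
      · simp [hvI]
      · simpa [hvI] using hid v fun hvS => hv (Finset.mem_sdiff.2 ⟨hvS, hvI⟩)
    · obtain ⟨k, hk⟩ := hreach v (Finset.mem_sdiff.1 hv).1
      have hvR := Finset.disjoint_left.1 hSR (Finset.mem_sdiff.1 hv).1
      clear hv
      induction k generalizing v with
      | zero => exact absurd hk hvR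
      | succ k ih =>
        rw [Function.iterate_succ_apply] at hk
        by_cases hvI : v ∈ I
        · exact ⟨0, hvI⟩
        have hpv : p v ∉ R := by
          intro hpv
          refine hvI (hpI ▸ Finset.mem_filter.2 ⟨?_, hpv⟩)
          by_contra hvS
          exact hvR (hid v hvS ▸ hpv)
        obtain ⟨l, hl⟩ := ih (p v) hk hpv
        refine ⟨l + 1, ?_⟩
        rw [Function.iterate_succ_apply]
        simpa [hvI] using hl
  · rintro ⟨f, g⟩ hfg
    obtain ⟨hf, hg⟩ := Finset.mem_product.1 hfg
    obtain ⟨hid, hreach⟩ := mem_forestMaps.1 hg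
    have hf' : ∀ v ∈ I, f v ∈ R := fun v hv => by
      simpa [hv] using Fintype.mem_piFinset.1 hf v
    have key : ∀ k v, g^[k] v ∈ I → ∃ l : ℕ, (fun v => if v ∈ I then f v else g v)^[l] v ∈ R := by
      intro k
      induction k with
      | zero =>
        intro v hv
        exact ⟨1, by simpa [show v ∈ I from hv] using hf' v hv⟩
      | succ k ih =>
        intro v hv
        by_cases hvI : v ∈ I
        · exact ⟨1, by simpa [hvI] using hf' v hvI⟩
        · obtain ⟨l, hl⟩ := ih (g v) hv
          refine ⟨l + 1, ?_⟩
          rw [Function.iterate_succ_apply]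
          simpa [hvI] using hl
    refine Finset.mem_filter.2 ⟨mem_forestMaps.2 ⟨fun v hv => ?_, fun v hv => ?_⟩, ?_⟩
    · simpa [show v ∉ I from fun h => hv (hI h)] using
        hid v fun h => hv (Finset.mem_sdiff.1 h).1
    · by_cases hvI : v ∈ I
      · exact key 0 v hvI
      · obtain ⟨k, hk⟩ := hreach v (Finset.mem_sdiff.2 ⟨hv, hvI⟩)
        exact key k v hk
    · ext v
      rw [Finset.mem_filter]
      constructor
      · rintro ⟨hvS, hv⟩
        by_contra hvI
        -- `g` fixes the vertices of `R`, so from `v` it would never reach `I`.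
        have hgv : g v ∈ R := by simpa [hvI] using hv
        have hgvS := Finset.disjoint_right.1 hSR hgv
        obtain ⟨_ | k, hk⟩ := hreach v (Finset.mem_sdiff.2 ⟨hvS, hvI⟩)
        · exact hvI hk
        · rw [Function.iterate_succ_apply, Function.iterate_fixed
            (hid _ fun h => hgvS (Finset.mem_sdiff.1 h).1)] at hk
          exact hgvS (hI hk)
      · intro hv
        exact ⟨hI hv, by simpa [hv] using hf' v hv⟩
  · intro p _
    funext v
    by_cases hv : v ∈ I <;> simp [hv]
  · rintro ⟨f, g⟩ hfg
    obtain ⟨hf, hg⟩ := Finset.mem_product.1 hfg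
    refine Prod.ext (funext fun v => ?_) (funext fun v => ?_)
    · by_cases hv : v ∈ I
      · simp [hv]
      · simpa [hv, eq_comm] using Fintype.mem_piFinset.1 hf v
    · by_cases hv : v ∈ I
      · simpa [hv, eq_comm] using (mem_forestMaps.1 hg).1 v (by simp [hv])
      · simp [hv]

/-- The derivative of the binomial theorem. -/
theorem sum_range_choose_mul_pow (r t : ℕ) :
    ∑ m ∈ Finset.range (t + 2), (t + 1).choose m * (m * (r ^ m * (t + 1) ^ (t + 1 - m))) =
      (t + 1) * (r * (r + (t + 1)) ^ t) := by
  rw [Finset.sum_range_succ', add_pow r (t + 1) t, Finset.mul_sum, Finset.mul_sum]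
  simp only [zero_mul, mul_zero, add_zero]
  refine Finset.sum_congr rfl fun m _ => ?_
  have h := Nat.add_one_mul_choose_eq t m
  rw [Nat.add_sub_add_right, pow_succ, Nat.cast_id]
  calc _ = (t + 1).choose (m + 1) * (m + 1) * (r ^ m * r * (t + 1) ^ (t - m)) := by ring
    _ = _ := by rw [← h]; ring

/-- Cayley's formula for rooted forests with a given root set. -/
theorem card_forestMaps_mul (S R : Finset V) (hSR : Disjoint S R) :
    (forestMaps S R).card * (R.card + S.card) = R.card * (R.card + S.card) ^ S.card := by
  induction hs : S.card using Nat.strong_induction_on generalizing S R with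
  | _ s ih =>
    subst hs
    rcases S.eq_empty_or_nonempty with rfl | hS
    · simp [forestMaps_empty_left]
    obtain ⟨t, ht⟩ : ∃ t, S.card = t + 1 := Nat.exists_eq_succ_of_ne_zero hS.card_pos.ne'
    have hfib : ∀ I ∈ S.powerset, S.card * (R.card ^ I.card * (forestMaps (S \ I) I).card) =
        I.card * (R.card ^ I.card * S.card ^ (S.card - I.card)) := by
      intro I hI
      rw [Finset.mem_powerset] at hI
      rcases I.eq_empty_or_nonempty with rfl | hI0
      · simp [forestMaps_empty_right hS]
      · have hc := Finset.card_sdiff_of_subset hI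
        have hle := Finset.card_le_card hI
        have := ih _ (by have := hI0.card_pos; omega) (S \ I) I Finset.sdiff_disjoint hc
        rw [Nat.add_sub_cancel' hle] at this
        calc _ = R.card ^ I.card * ((forestMaps (S \ I) I).card * S.card) := by ring
          _ = _ := by rw [this]; ring
    have hcard : S.card * (forestMaps S R).card = S.card * (R.card * (R.card + S.card) ^ t) := by
      rw [Finset.card_eq_sum_card_fiberwise (t := S.powerset)
        (f := fun p : V → V => S.filter fun v => p v ∈ R)
        (fun p _ => Finset.mem_powerset.2 (Finset.filter_subset _ _)),
        Finset.sum_congr rfl fun I hI => card_forestMaps_fiber hSR (Finset.mem_powerset.1 hI),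
        Finset.mul_sum, Finset.sum_congr rfl hfib,
        Finset.sum_powerset_apply_card (fun m => m * (R.card ^ m * S.card ^ (S.card - m))), ht]
      exact sum_range_choose_mul_pow R.card t
    rw [Nat.eq_of_mul_eq_mul_left hS.card_pos hcard, ht, pow_succ, mul_assoc]

/-! ### Counting perfect matchings -/

/-- The perfect matchings of `R`, as involutions of `V` that move exactly the elements of `R`. -/
def matchings (R : Finset V) : Finset (V → V) :=
  Finset.univ.filter fun m => (∀ v, m (m v) = v) ∧ ∀ v, m v ≠ v ↔ v ∈ R

theorem mem_matchings {R : Finset V} {m : V → V} :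
    m ∈ matchings R ↔ (∀ v, m (m v) = v) ∧ ∀ v, m v ≠ v ↔ v ∈ R := by
  simp [matchings]

/-- The matchings in which `x` is matched to `y` correspond to the matchings of the rest. -/
theorem card_matchings_fiber {R : Finset V} {x y : V} (hx : x ∈ R) (hy : y ∈ R) (hxy : y ≠ x) :
    ((matchings R).filter fun m => m x = y).card = (matchings ((R.erase x).erase y)).card := by
  refine Finset.card_nbij' (fun m => Function.update (Function.update m x x) y y)
    (fun m => Function.update (Function.update m x y) y x) ?_ ?_ ?_ ?_
  · intro m hm
    obtain ⟨hm, hmx⟩ := Finset.mem_filter.1 hm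
    obtain ⟨hinv, hsupp⟩ := mem_matchings.1 hm
    have hmy : m y = x := by rw [← hmx, hinv]
    refine mem_matchings.2 ⟨fun v => ?_, fun v => ?_⟩
    · by_cases hvy : v = y
      · subst hvy; simp
      by_cases hvx : v = x
      · subst hvx; simp [hxy.symm]
      have h1 : m v ≠ x := fun h => hvy (by rw [← hmx, ← h, hinv])
      have h2 : m v ≠ y := fun h => hvx (by rw [← hmy, ← h, hinv])
      simp [hvx, hvy, h1, h2, hinv]
    · by_cases hvy : v = y
      · subst hvy; simp
      by_cases hvx : v = x
      · subst hvx; simp [hxy.symm]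
      simpa [hvx, hvy] using hsupp v
  · intro m hm
    obtain ⟨hinv, hsupp⟩ := mem_matchings.1 hm
    have hmx : m x = x := by
      by_contra h
      simpa using (hsupp x).1 h
    have hmy : m y = y := by
      by_contra h
      simpa using (hsupp y).1 h
    refine Finset.mem_filter.2 ⟨mem_matchings.2 ⟨fun v => ?_, fun v => ?_⟩, by simp [hxy.symm]⟩
    · by_cases hvy : v = y
      · subst hvy; simp [hxy.symm]
      by_cases hvx : v = x
      · subst hvx; simp [hxy.symm]
      have h1 : m v ≠ x := fun h => hvx (by rw [← hinv v, h, hmx])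
      have h2 : m v ≠ y := fun h => hvy (by rw [← hinv v, h, hmy])
      simp [hvx, hvy, h1, h2, hinv]
    · by_cases hvy : v = y
      · subst hvy; simp [hxy.symm, hy]
      by_cases hvx : v = x
      · subst hvx; simp [hxy.symm, hxy, hx]
      simpa [hvx, hvy] using hsupp v
  · intro m hm
    obtain ⟨hm, hmx⟩ := Finset.mem_filter.1 hm
    have hmy : m y = x := by rw [← hmx, (mem_matchings.1 hm).1]
    funext v
    by_cases hvy : v = y
    · subst hvy; simp [hmy]
    by_cases hvx : v = x
    · subst hvx; simp [hxy.symm, hmx]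
    simp [hvx, hvy]
  · intro m hm
    obtain ⟨hinv, hsupp⟩ := mem_matchings.1 hm
    have hmx : m x = x := by
      by_contra h
      simpa using (hsupp x).1 h
    have hmy : m y = y := by
      by_contra h
      simpa using (hsupp y).1 h
    funext v
    by_cases hvy : v = y
    · subst hvy; simp [hmy]
    by_cases hvx : v = x
    · subst hvx; simp [hxy.symm, hmx]
    simp [hvx, hvy]

theorem card_matchings (j : ℕ) (R : Finset V) (hR : R.card = 2 * j) :
    (matchings R).card = Nat.doubleFactorial (2 * j - 1) := by
  induction j generalizing R with
  | zero =>
    obtain rfl := Finset.card_eq_zero.1 hR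
    have : matchings (∅ : Finset V) = {id} := by
      ext m
      simp only [mem_matchings, Finset.notMem_empty, iff_false, not_not, Finset.mem_singleton,
        funext_iff, id]
      exact ⟨fun h => h.2, fun h => ⟨fun v => by rw [h, h], h⟩⟩
    rw [this]
    rfl
  | succ j ih =>
    obtain ⟨x, hx⟩ : R.Nonempty := Finset.card_pos.1 (by omega)
    have hmaps : ∀ m ∈ matchings R, m x ∈ R.erase x := by
      intro m hm
      obtain ⟨hinv, hsupp⟩ := mem_matchings.1 hm
      have hmx := (hsupp x).2 hx
      exact Finset.mem_erase.2 ⟨hmx, (hsupp _).1 (by rw [hinv]; exact hmx.symm)⟩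
    rw [Finset.card_eq_sum_card_fiberwise hmaps,
      Finset.sum_congr rfl fun y hy => (card_matchings_fiber hx (Finset.mem_erase.1 hy).2
        (Finset.mem_erase.1 hy).1).trans (ih _ (by
          rw [Finset.card_erase_of_mem hy, Finset.card_erase_of_mem hx]; omega)),
      Finset.sum_const, Finset.card_erase_of_mem hx, hR, smul_eq_mul]
    rcases j with _ | j
    · rfl
    · rw [show 2 * (j + 1 + 1) - 1 = (2 * j + 1) + 2 by omega,
        show 2 * (j + 1) - 1 = 2 * j + 1 by omega, Nat.doubleFactorial_add_two]

end Counting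

/-! ### Counting partially-paired forests -/

namespace PPRForest

variable {n : ℕ}

/-- The roots of the paired trees. -/
def pairedRoots (F : PPRForest n) : Finset (Fin (n + 1)) :=
  Finset.univ.filter fun v => v ≠ 0 ∧ F.parent v = v

theorem mem_pairedRoots {F : PPRForest n} {v : Fin (n + 1)} :
    v ∈ F.pairedRoots ↔ v ≠ 0 ∧ F.parent v = v := by
  simp [pairedRoots]

theorem card_pairedRoots (F : PPRForest n) : F.pairedRoots.card = 2 * F.pairCount := by
  rw [two_mul_pairCount]
  congr 1
  ext v
  simp [mem_pairedRoots, F.mate_ne_iff]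

theorem pairedRoots_subset (F : PPRForest n) : F.pairedRoots ⊆ Finset.univ.erase 0 := fun _ hv =>
  Finset.mem_erase.2 ⟨(mem_pairedRoots.1 hv).1, Finset.mem_univ _⟩

theorem two_mul_pairCount_le (F : PPRForest n) : 2 * F.pairCount ≤ n := by
  rw [← card_pairedRoots]
  exact (Finset.card_le_card F.pairedRoots_subset).trans (by simp)

open Classical in
theorem card_pairedRoots_eq {R : Finset (Fin (n + 1))} (hR : (0 : Fin (n + 1)) ∉ R) :
    (Finset.univ.filter fun F : PPRForest n => F.pairedRoots = R).card =
      (forestMaps (Finset.univ \ insert 0 R) (insert 0 R)).card * (matchings R).card := by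
  rw [← Finset.card_product]
  refine Finset.card_bij (fun F _ => (F.parent, F.mate)) ?_
    (fun F _ G _ h => injective_parent_mate n h) ?_
  · intro F hF
    obtain rfl := (Finset.mem_filter.1 hF).2
    refine Finset.mem_product.2 ⟨mem_forestMaps.2 ⟨fun v hv => ?_, fun v _ => ?_⟩,
      mem_matchings.2 ⟨F.mate_mate, fun v => (F.mate_ne_iff v).trans mem_pairedRoots.symm⟩⟩
    · rw [Finset.mem_sdiff, not_and_not_right, Finset.mem_insert] at hv
      rcases hv (Finset.mem_univ v) with rfl | hv
      · exact F.parent_zero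
      · exact (mem_pairedRoots.1 hv).2
    · obtain ⟨k, hk⟩ := F.exists_root v
      refine ⟨k, Finset.mem_insert.2 ?_⟩
      by_cases h0 : F.parent^[k] v = 0
      · exact .inl h0
      · exact .inr (mem_pairedRoots.2 ⟨h0, hk⟩)
  · rintro ⟨p, m⟩ hpm
    obtain ⟨hp, hm⟩ := Finset.mem_product.1 hpm
    obtain ⟨hid, hreach⟩ := mem_forestMaps.1 hp
    obtain ⟨hinv, hsupp⟩ := mem_matchings.1 hm
    have hfix : ∀ v, v ∈ insert 0 R ↔ p v = v := by
      intro v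
      refine ⟨fun hv => hid v (by simp [Finset.mem_insert.1 hv]), fun hv => ?_⟩
      by_contra hvR
      obtain ⟨k, hk⟩ := hreach v (Finset.mem_sdiff.2 ⟨Finset.mem_univ v, hvR⟩)
      rw [Function.iterate_fixed hv] at hk
      exact hvR hk
    have hR' : ∀ v, v ≠ 0 ∧ p v = v ↔ v ∈ R := by
      intro v
      rw [← hfix, Finset.mem_insert]
      refine ⟨fun h => h.2.resolve_left h.1, fun h => ⟨?_, .inr h⟩⟩
      rintro rfl
      exact hR h
    refine ⟨⟨p, (hfix 0).1 (Finset.mem_insert_self _ _), fun v => ?_, m, hinv,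
      fun v => (hsupp v).trans (hR' v).symm⟩, ?_, rfl⟩
    · by_cases hv : v ∈ insert 0 R
      · exact ⟨0, (hfix v).1 hv⟩
      · obtain ⟨k, hk⟩ := hreach v (Finset.mem_sdiff.2 ⟨Finset.mem_univ v, hv⟩)
        exact ⟨k, (hfix _).1 hk⟩
    · refine Finset.mem_filter.2 ⟨Finset.mem_univ _, ?_⟩
      ext v
      exact mem_pairedRoots.trans (hR' v)

/-- The number of partially-paired rooted forests with pair-count `j`, with the denominator
cleared. -/
theorem card_pairCount_mul (n j : ℕ) :
    Nat.card {F : PPRForest n // F.pairCount = j} * (n + 1) =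
      n.choose (2 * j) * Nat.doubleFactorial (2 * j - 1) *
        ((2 * j + 1) * (n + 1) ^ (n - 2 * j)) := by
  classical
  have hmaps : ∀ F ∈ Finset.univ.filter (fun F : PPRForest n => F.pairCount = j),
      F.pairedRoots ∈ (Finset.univ.erase (0 : Fin (n + 1))).powersetCard (2 * j) := fun F hF =>
    Finset.mem_powersetCard.2
      ⟨F.pairedRoots_subset, by rw [card_pairedRoots, (Finset.mem_filter.1 hF).2]⟩
  have hfib : ∀ R ∈ (Finset.univ.erase (0 : Fin (n + 1))).powersetCard (2 * j),
      ((Finset.univ.filter fun F : PPRForest n => F.pairCount = j).filter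
        fun F => F.pairedRoots = R).card * (n + 1) =
      Nat.doubleFactorial (2 * j - 1) * ((2 * j + 1) * (n + 1) ^ (n - 2 * j)) := by
    intro R hR
    obtain ⟨hR, hcard⟩ := Finset.mem_powersetCard.1 hR
    have h0 : (0 : Fin (n + 1)) ∉ R := fun h => Finset.notMem_erase _ _ (hR h)
    have hle : 2 * j ≤ n := by
      rw [← hcard]
      exact (Finset.card_le_card hR).trans (by simp)
    have hfilter : ((Finset.univ.filter fun F : PPRForest n => F.pairCount = j).filter
        fun F => F.pairedRoots = R) =
        Finset.univ.filter fun F : PPRForest n => F.pairedRoots = R := by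
      rw [Finset.filter_filter]
      refine Finset.filter_congr fun F _ => ⟨fun h => h.2, fun h => ⟨?_, h⟩⟩
      have := F.card_pairedRoots
      rw [h, hcard] at this
      omega
    have hforest := card_forestMaps_mul (Finset.univ \ insert 0 R) (insert 0 R)
      Finset.sdiff_disjoint
    rw [Finset.card_sdiff_of_subset (Finset.subset_univ _), Finset.card_insert_of_notMem h0,
      Finset.card_univ, Fintype.card_fin, hcard, show n + 1 - (2 * j + 1) = n - 2 * j by omega,
      show 2 * j + 1 + (n - 2 * j) = n + 1 by omega] at hforest
    rw [hfilter, card_pairedRoots_eq h0, card_matchings j R hcard, mul_right_comm, hforest,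
      mul_comm]
  rw [Nat.card_eq_fintype_card, Fintype.card_subtype, Finset.card_eq_sum_card_fiberwise hmaps,
    Finset.sum_mul, Finset.sum_congr rfl hfib, Finset.sum_const, Finset.card_powersetCard,
    Finset.card_erase_of_mem (Finset.mem_univ _), Finset.card_univ, Fintype.card_fin, smul_eq_mul,
    Nat.add_sub_cancel, mul_assoc]

theorem card_pairCount (n j : ℕ) :
    (Nat.card {F : PPRForest n // F.pairCount = j} : ℚ) =
      ((n.choose (2 * j) : ℚ) * (Nat.doubleFactorial (2 * j - 1) : ℚ)) *
        ((2 * (j : ℚ) + 1) * ((n : ℚ) + 1) ^ ((n : ℤ) - 2 * (j : ℤ) - 1)) := by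
  have hn : (n : ℚ) + 1 ≠ 0 := by positivity
  have h : (Nat.card {F : PPRForest n // F.pairCount = j} : ℚ) * ((n : ℚ) + 1) =
      n.choose (2 * j) * Nat.doubleFactorial (2 * j - 1) *
        ((2 * j + 1) * ((n : ℚ) + 1) ^ (n - 2 * j)) := mod_cast card_pairCount_mul n j
  refine mul_right_cancel₀ hn (h.trans ?_)
  rcases le_or_gt (2 * j) n with hj | hj
  · rw [zpow_sub_one₀ hn, show (n : ℤ) - 2 * (j : ℤ) = ((n - 2 * j : ℕ) : ℤ) by omega, zpow_natCast]
    field_simp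
  -- Here the power of `n + 1` has a negative exponent, but the binomial coefficient vanishes.
  · simp [Nat.choose_eq_zero_of_lt hj]

theorem sum_weight (n : ℕ) :
    ((∑ F : PPRForest n, F.weight : ℤ) : ℚ) =
      ∑ j ∈ Finset.range (n / 2 + 1),
        (-1 : ℚ) ^ j * ((n.choose (2 * j) : ℚ) * (Nat.doubleFactorial (2 * j - 1) : ℚ)) *
          ((2 * (j : ℚ) + 1) * ((n : ℚ) + 1) ^ ((n : ℤ) - 2 * (j : ℤ) - 1)) := by
  classical
  rw [← Finset.sum_fiberwise_of_maps_to (t := Finset.range (n / 2 + 1)) (g := pairCount)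
    (fun F _ => Finset.mem_range.2 (by have := F.two_mul_pairCount_le; omega)), Int.cast_sum]
  refine Finset.sum_congr rfl fun j _ => ?_
  rw [Finset.sum_congr rfl fun F hF => show F.weight = (-1) ^ j by
      rw [weight, (Finset.mem_filter.1 hF).2],
    Finset.sum_const, ← Fintype.card_subtype, ← Nat.card_eq_fintype_card, mul_assoc,
    ← card_pairCount, nsmul_eq_mul]
  push_cast
  ring

theorem Special.weight_eq_one {F : PPRForest n} (hF : F.Special) : F.weight = 1 := by
  rw [weight, hF.1, pow_zero]

/-- The forests that are not special cancel, and the special ones encode the unrooted forests. -/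
theorem card_isAcyclic (n : ℕ) :
    (Nat.card {G : SimpleGraph (Fin n) // G.IsAcyclic} : ℤ) = ∑ F : PPRForest n, F.weight := by
  classical
  obtain ⟨φ, hφ, hw, -⟩ := exists_signReversing_involution n
  have hcancel : ∑ F : {F : PPRForest n // ¬ F.Special}, F.1.weight = 0 := by
    have h := Equiv.sum_comp hφ.toPerm fun F => F.1.weight
    simp only [Function.Involutive.coe_toPerm, hw, Finset.sum_neg_distrib] at h
    omega
  have hspecial : ∑ F : {F : PPRForest n // F.Special}, F.1.weight =
      Nat.card {F : PPRForest n // F.Special} := by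
    rw [Finset.sum_congr rfl fun F _ => F.2.weight_eq_one, Finset.sum_const, Finset.card_univ,
      Nat.card_eq_fintype_card, nsmul_eq_mul, mul_one]
  rw [← Fintype.sum_subtype_add_sum_subtype (fun F : PPRForest n => F.Special) weight, hcancel,
    add_zero, hspecial]
  exact congrArg _ (Nat.card_congr (bijOn_deleteZero (n := n)).equiv).symm

end PPRForest

/-- The two forms of the summand agree. -/
theorem factorial_summand_eq {n j : ℕ} (hj : 2 * j ≤ n) :
    (n.factorial : ℚ) / ((n : ℚ) + 1) *
        ((-1 : ℚ) ^ j * ((2 * (j : ℚ) + 1) * ((n : ℚ) + 1) ^ (n - 2 * j)) /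
          (2 ^ j * (j.factorial : ℚ) * ((n - 2 * j).factorial : ℚ))) =
      (-1 : ℚ) ^ j * ((n.choose (2 * j) : ℚ) * (Nat.doubleFactorial (2 * j - 1) : ℚ)) *
        ((2 * (j : ℚ) + 1) * ((n : ℚ) + 1) ^ ((n : ℤ) - 2 * (j : ℤ) - 1)) := by
  have hn : (n : ℚ) + 1 ≠ 0 := by positivity
  have h1 : (2 * j).factorial = 2 ^ j * j.factorial * Nat.doubleFactorial (2 * j - 1) := by
    rw [← Nat.doubleFactorial_two_mul]
    rcases j with _ | j
    · rfl
    · exact Nat.factorial_eq_mul_doubleFactorial (2 * j + 1)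
  have h2 : (n.factorial : ℚ) = n.choose (2 * j) *
      (2 ^ j * j.factorial * Nat.doubleFactorial (2 * j - 1)) * (n - 2 * j).factorial := by
    rw [← Nat.choose_mul_factorial_mul_factorial hj, h1]
    push_cast
    ring
  rw [zpow_sub_one₀ hn, show (n : ℤ) - 2 * (j : ℤ) = ((n - 2 * j : ℕ) : ℤ) by omega,
    zpow_natCast, h2]
  field_simp

theorem mainTheorem1 (n : ℕ) :
    -- the number of forests of unrooted trees on `n` labelled vertices, in two forms
    (Nat.card {G : SimpleGraph (Fin n) // G.IsAcyclic} : ℚ) =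
        (n.factorial : ℚ) / ((n : ℚ) + 1) *
          ∑ j ∈ Finset.range (n / 2 + 1),
            (-1 : ℚ) ^ j * ((2 * (j : ℚ) + 1) * ((n : ℚ) + 1) ^ (n - 2 * j)) /
              (2 ^ j * (j.factorial : ℚ) * ((n - 2 * j).factorial : ℚ)) ∧
    (Nat.card {G : SimpleGraph (Fin n) // G.IsAcyclic} : ℚ) =
        ∑ j ∈ Finset.range (n / 2 + 1),
          (-1 : ℚ) ^ j * ((n.choose (2 * j) : ℚ) * (Nat.doubleFactorial (2 * j - 1) : ℚ)) *
            ((2 * (j : ℚ) + 1) * ((n : ℚ) + 1) ^ ((n : ℤ) - 2 * (j : ℤ) - 1)) ∧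
    -- the number of partially-paired rooted forests with a given pair-count
    (∀ j : ℕ, (Nat.card {F : PPRForest n // F.pairCount = j} : ℚ) =
        ((n.choose (2 * j) : ℚ) * (Nat.doubleFactorial (2 * j - 1) : ℚ)) *
          ((2 * (j : ℚ) + 1) * ((n : ℚ) + 1) ^ ((n : ℤ) - 2 * (j : ℤ) - 1))) ∧
    -- the sum is their total weight
    ((∑ F : PPRForest n, F.weight : ℤ) : ℚ) =
        ∑ j ∈ Finset.range (n / 2 + 1),
          (-1 : ℚ) ^ j * ((n.choose (2 * j) : ℚ) * (Nat.doubleFactorial (2 * j - 1) : ℚ)) *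
            ((2 * (j : ℚ) + 1) * ((n : ℚ) + 1) ^ ((n : ℤ) - 2 * (j : ℤ) - 1)) ∧
    -- the special ones have weight 1 and encode the unrooted forests
    (∀ F : PPRForest n, F.Special → F.weight = 1) ∧
    Set.BijOn PPRForest.deleteZero {F : PPRForest n | F.Special}
        {G : SimpleGraph (Fin n) | G.IsAcyclic} ∧
    -- the weight-reversing involution on the others
    ∃ φ : {F : PPRForest n // ¬ F.Special} → {F : PPRForest n // ¬ F.Special},
      Function.Involutive φ ∧
      (∀ F : {F : PPRForest n // ¬ F.Special}, (φ F).1.weight = -F.1.weight) ∧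
      ∀ F : {F : PPRForest n // ¬ F.Special}, F.1.JoinsTo (φ F).1 ∨ F.1.SplitsTo (φ F).1 := by
  have hcard : (Nat.card {G : SimpleGraph (Fin n) // G.IsAcyclic} : ℚ) =
      ((∑ F : PPRForest n, F.weight : ℤ) : ℚ) := mod_cast PPRForest.card_isAcyclic n
  refine ⟨?_, hcard.trans (PPRForest.sum_weight n), PPRForest.card_pairCount n,
    PPRForest.sum_weight n, fun F hF => hF.weight_eq_one, PPRForest.bijOn_deleteZero,
    PPRForest.exists_signReversing_involution n⟩
  rw [hcard, PPRForest.sum_weight, Finset.mul_sum]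
  refine Finset.sum_congr rfl fun j hj => (factorial_summand_eq ?_).symm
  have := Finset.mem_range.1 hj
  omega
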